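/- Let $q$ be a complex number with $|q|<1$. Write $(q;q)_n=\prod_{i=1}^{n}(1-q^i)$ for $n\ge 0$ and $(q;q)_\infty=\prod_{i=1}^{\infty}(1-q^i)$. Then the infinite product $(q;q)_\infty$ converges and is nonzero, both series below converge absolutely, and $$\sum_{n\ge 0}\frac{q^{2n^2+2n}}{(q;q)_{2n+1}}=\frac{1}{(q;q)_\infty}\sum_{k\in\mathbb{Z}}\left(q^{12k^2+5k}-q^{12k^2-13k+3}\right).$$ -/

import Mathlib

/-- The finite `q`-Pochhammer symbol `(a; q)_n = (1 - a) (1 - a q) ⋯ (1 - a q^(n-1))`. -/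
noncomputable def qPoch (a q : ℂ) (n : ℕ) : ℂ :=
  ∏ i ∈ Finset.range n, (1 - a * q ^ i)

/-- The infinite `q`-Pochhammer symbol `(a; q)_∞ = ∏_{i ≥ 0} (1 - a q^i)`. -/
noncomputable def qPochInf (a q : ℂ) : ℂ :=
  ∏' i : ℕ, (1 - a * q ^ i)

open Filter Topology

/-! ### Convergence and nonvanishing of the products. -/

section Product

variable {q : ℂ}

/-! Put `q = t²`. In Euler's expansion of `(-z; q)_∞` at `z = t`, the odd-index terms are `t` times
those of the left series; hence `2t` times that series is `(-t; t²)_∞ - (t; t²)_∞`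
(`two_mul_mul_tsum_odd`). Multiplying by `(t²; t²)_∞` turns this into `φ(-t) - φ(t)`, where `φ(t) =
∏ (1 - t^n)` over `n ≥ 1`. By the pentagonal number theorem only odd pentagonal exponents survive in
that difference, and they give `2t` times the right series (`two_mul_mul_tsum_zpow`). -/

theorem summable_norm_neg_mul_pow (hq : ‖q‖ < 1) (a : ℂ) :
    Summable (fun i : ℕ => ‖-(a * q ^ i)‖) := by
  simpa using (summable_geometric_of_lt_one (norm_nonneg q) hq).mul_left ‖a‖

theorem multipliable_one_sub_mul_pow (hq : ‖q‖ < 1) (a : ℂ) :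
    Multipliable (fun i : ℕ => 1 - a * q ^ i) := by
  simpa [sub_eq_add_neg] using
    multipliable_one_add_of_summable (summable_norm_neg_mul_pow hq a)

theorem one_sub_pow_succ_ne_zero (hq : ‖q‖ < 1) (i : ℕ) : 1 - q ^ (i + 1) ≠ 0 := by
  intro h
  have h1 : ‖q‖ ^ (i + 1) = 1 := by rw [← norm_pow, ← sub_eq_zero.mp h, norm_one]
  exact (pow_lt_one₀ (norm_nonneg q) hq i.succ_ne_zero).ne h1

theorem qPoch_self_ne_zero (hq : ‖q‖ < 1) (n : ℕ) : qPoch q q n ≠ 0 := by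
  refine Finset.prod_ne_zero_iff.mpr fun i _ => ?_
  simpa [pow_succ'] using one_sub_pow_succ_ne_zero hq i

theorem qPochInf_self_ne_zero (hq : ‖q‖ < 1) : qPochInf q q ≠ 0 := by
  have h := tprod_one_add_ne_zero_of_summable (f := fun i : ℕ => -(q * q ^ i))
    (fun i => by simpa [pow_succ', sub_eq_add_neg] using one_sub_pow_succ_ne_zero hq i)
    (summable_norm_neg_mul_pow hq q)
  simpa [qPochInf, sub_eq_add_neg] using h

/-- Splitting `(t; t)_∞` into its odd and even factors. -/
theorem qPochInf_mul_qPochInf_sq {t : ℂ} (ht : ‖t‖ < 1) :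
    qPochInf t (t ^ 2) * qPochInf (t ^ 2) (t ^ 2) = ∏' n : ℕ, (1 - t ^ (n + 1)) := by
  have ht2 : ‖t ^ 2‖ < 1 := by
    rw [norm_pow]; exact pow_lt_one₀ (norm_nonneg t) ht two_ne_zero
  have he : (fun k : ℕ => 1 - t ^ (2 * k + 1)) = fun k => 1 - t * (t ^ 2) ^ k := by
    ext k; ring
  have ho : (fun k : ℕ => 1 - t ^ (2 * k + 1 + 1)) = fun k => 1 - t ^ 2 * (t ^ 2) ^ k := by
    ext k; ring
  rw [← tprod_even_mul_odd (f := fun n : ℕ => 1 - t ^ (n + 1))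
    (by rw [he]; exact multipliable_one_sub_mul_pow ht2 _)
    (by rw [ho]; exact multipliable_one_sub_mul_pow ht2 _), he, ho]
  rfl

end Product

/-! ### Euler's expansion and its odd part. -/

section Euler

/-- The `m`-th term of Euler's expansion of `(-z; q)_∞`. -/
noncomputable def eulerTerm (q z : ℂ) (m : ℕ) : ℂ :=
  q ^ (m.choose 2) / qPoch q q m * z ^ m

variable {q : ℂ}

theorem eulerTerm_succ_mul (hq : ‖q‖ < 1) (z : ℂ) (m : ℕ) :
    eulerTerm q z (m + 1) * (1 - q ^ (m + 1)) = z * q ^ m * eulerTerm q z m := by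
  have h1 := qPoch_self_ne_zero hq m
  have h2 := one_sub_pow_succ_ne_zero hq m
  have h3 : qPoch q q (m + 1) = qPoch q q m * (1 - q ^ (m + 1)) := by
    rw [qPoch, Finset.prod_range_succ, ← pow_succ', qPoch]
  have h4 : (m + 1).choose 2 = m + m.choose 2 := by
    rw [Nat.choose_succ_succ' m 1, Nat.choose_one_right]
  rw [eulerTerm, eulerTerm, h3, h4]
  field_simp
  ring

theorem eulerTerm_mul (q z w : ℂ) (m : ℕ) :
    eulerTerm q (z * w) m = w ^ m * eulerTerm q z m := by
  rw [eulerTerm, eulerTerm]; ring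

theorem eulerTerm_zero (q z : ℂ) : eulerTerm q z 0 = 1 := by
  simp [eulerTerm, qPoch]

theorem summable_eulerTerm (hq : ‖q‖ < 1) (z : ℂ) : Summable (eulerTerm q z) := by
  have hlim : Tendsto (fun m : ℕ => ‖z * q ^ m / (1 - q ^ (m + 1))‖) atTop (𝓝 0) := by
    have h := tendsto_pow_atTop_nhds_zero_of_norm_lt_one hq
    have h' := (tendsto_add_atTop_iff_nat 1).mpr h
    simpa using ((h.const_mul z).div (h'.const_sub 1) (by simp)).norm
  refine summable_of_ratio_norm_eventually_le (r := 1 / 2) (by norm_num) ?_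
  filter_upwards [hlim.eventually_le_const (u := (1 / 2 : ℝ)) (by norm_num)] with m hm
  have h : eulerTerm q z (m + 1) = z * q ^ m / (1 - q ^ (m + 1)) * eulerTerm q z m := by
    rw [div_mul_eq_mul_div, eq_div_iff (one_sub_pow_succ_ne_zero hq m), eulerTerm_succ_mul hq]
  rw [h, norm_mul]
  gcongr

/-- This functional equation, iterated `n` times, extracts the first `n` factors of the product;
what remains is the series at `z q^n`, which tends to `1`. -/
theorem tsum_eulerTerm_eq_mul (hq : ‖q‖ < 1) (z : ℂ) :
    ∑' m, eulerTerm q z m = (1 + z) * ∑' m, eulerTerm q (z * q) m := by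
  have hz := summable_eulerTerm hq z
  have hzq := summable_eulerTerm hq (z * q)
  have hstep (m : ℕ) : eulerTerm q z (m + 1) =
      eulerTerm q (z * q) (m + 1) + z * eulerTerm q (z * q) m := by
    rw [eulerTerm_mul, eulerTerm_mul]
    linear_combination eulerTerm_succ_mul hq z m
  rw [hz.tsum_eq_zero_add]
  simp_rw [hstep]
  rw [((summable_nat_add_iff 1).mpr hzq).tsum_add (hzq.mul_left z), tsum_mul_left, add_mul,
    one_mul, eulerTerm_zero, ← add_assoc]
  congr 1
  rw [hzq.tsum_eq_zero_add, eulerTerm_zero]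

theorem tsum_eulerTerm_eq_qPoch_mul (hq : ‖q‖ < 1) (z : ℂ) (n : ℕ) :
    ∑' m, eulerTerm q z m = qPoch (-z) q n * ∑' m, eulerTerm q (z * q ^ n) m := by
  induction n with
  | zero => simp [qPoch]
  | succ n ih =>
    rw [ih, tsum_eulerTerm_eq_mul hq (z * q ^ n), qPoch, qPoch, Finset.prod_range_succ, pow_succ,
      mul_assoc z]
    ring

/-- **Euler's identity**: `∑ q^(m(m-1)/2) z^m / (q; q)_m = (-z; q)_∞`. -/
theorem tsum_eulerTerm (hq : ‖q‖ < 1) (z : ℂ) :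
    ∑' m, eulerTerm q z m = qPochInf (-z) q := by
  have hpow := tendsto_pow_atTop_nhds_zero_of_norm_lt_one hq
  have hlim : Tendsto (fun n : ℕ => ∑' m, eulerTerm q (z * q ^ n) m) atTop (𝓝 1) := by
    have h : Tendsto (fun n : ℕ => ∑' m, eulerTerm q (z * q ^ n) m) atTop
        (𝓝 (∑' m, eulerTerm q (z * 0) m)) := by
      refine tendsto_tsum_of_dominated_convergence (summable_eulerTerm hq z).norm
        (fun m => ?_) (.of_forall fun n m => ?_)
      · simp_rw [eulerTerm_mul]
        exact (hpow.pow m).mul_const _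
      · rw [eulerTerm_mul, norm_mul]
        refine mul_le_of_le_one_left (norm_nonneg _) ?_
        rw [norm_pow, norm_pow]
        exact pow_le_one₀ (by positivity) (pow_le_one₀ (norm_nonneg q) hq.le)
    have h1 : ∑' m, eulerTerm q (z * 0) m = 1 := by
      rw [tsum_eq_single 0 fun m hm => by simp [eulerTerm, hm], eulerTerm_zero]
    rwa [h1] at h
  have hprod : Tendsto (fun n : ℕ => qPoch (-z) q n) atTop (𝓝 (qPochInf (-z) q)) :=
    (multipliable_one_sub_mul_pow hq (-z)).tendsto_prod_tprod_nat
  have h := hprod.mul hlim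
  simp_rw [← tsum_eulerTerm_eq_qPoch_mul hq, mul_one] at h
  exact tendsto_nhds_unique tendsto_const_nhds h

theorem eulerTerm_sq_odd (t : ℂ) (n : ℕ) :
    eulerTerm (t ^ 2) t (2 * n + 1) =
      t * ((t ^ 2) ^ (2 * n ^ 2 + 2 * n) / qPoch (t ^ 2) (t ^ 2) (2 * n + 1)) := by
  have h : (2 * n + 1).choose 2 = 2 * n ^ 2 + n := by
    rw [Nat.choose_two_right, Nat.add_sub_cancel]
    exact Nat.div_eq_of_eq_mul_left two_pos (by ring)
  rw [eulerTerm, h]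
  ring

/-- The odd part of Euler's identity at `z = t`, `q = t²`. -/
theorem two_mul_mul_tsum_odd {t : ℂ} (ht : ‖t ^ 2‖ < 1) :
    2 * t * ∑' n : ℕ, (t ^ 2) ^ (2 * n ^ 2 + 2 * n) / qPoch (t ^ 2) (t ^ 2) (2 * n + 1) =
      qPochInf (-t) (t ^ 2) - qPochInf t (t ^ 2) := by
  have hs := summable_eulerTerm ht t
  have hs' := summable_eulerTerm ht (-t)
  have hneg_even (n : ℕ) : eulerTerm (t ^ 2) (-t) (2 * n) = eulerTerm (t ^ 2) t (2 * n) := by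
    rw [← mul_neg_one, eulerTerm_mul, (even_two_mul n).neg_one_pow, one_mul]
  have hneg_odd (n : ℕ) :
      eulerTerm (t ^ 2) (-t) (2 * n + 1) = -eulerTerm (t ^ 2) t (2 * n + 1) := by
    rw [← mul_neg_one, eulerTerm_mul, (odd_two_mul_add_one n).neg_one_pow, neg_one_mul]
  have he : Function.Injective fun n : ℕ => 2 * n := fun a b h => by simpa using h
  have ho : Function.Injective fun n : ℕ => 2 * n + 1 := fun a b h => by simpa using h
  have h1 := tsum_eulerTerm ht t
  have h2 := tsum_eulerTerm ht (-t)
  rw [← tsum_even_add_odd (hs.comp_injective he) (hs.comp_injective ho)] at h1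
  rw [← tsum_even_add_odd (hs'.comp_injective he) (hs'.comp_injective ho), neg_neg] at h2
  simp_rw [hneg_even, hneg_odd, tsum_neg] at h2
  simp_rw [eulerTerm_sq_odd, tsum_mul_left] at h1 h2
  linear_combination h1 - h2

end Euler

/-! ### The pentagonal number theorem and its odd part. -/

section Pentagonal

variable {x : ℂ}

/-- From `1 + u ≤ exp u`. The uniformity in `k` and `n` is what controls the remainder in the
pentagonal recursion. -/
theorem norm_prod_one_sub_pow_le (hx : ‖x‖ < 1) (k n : ℕ) :
    ‖∏ i ∈ Finset.range n, (1 - x ^ (k + i + 1))‖ ≤ Real.exp (∑' i : ℕ, ‖x‖ ^ i) := by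
  rw [norm_prod]
  calc ∏ i ∈ Finset.range n, ‖1 - x ^ (k + i + 1)‖
      ≤ ∏ i ∈ Finset.range n, (1 + ‖x‖ ^ i) := by
        refine Finset.prod_le_prod (fun _ _ => norm_nonneg _) fun i _ => ?_
        refine (norm_sub_le _ _).trans ?_
        rw [norm_one, norm_pow]
        gcongr 1 + ?_
        exact pow_le_pow_of_le_one (norm_nonneg x) hx.le (by omega)
    _ ≤ Real.exp (∑ i ∈ Finset.range n, ‖x‖ ^ i) :=
        Real.prod_one_add_le_exp_sum _ fun _ => by positivity
    _ ≤ _ := Real.exp_le_exp.mpr <|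
        (summable_geometric_of_lt_one (norm_nonneg x) hx).sum_le_tsum _ fun _ _ => by positivity

theorem summable_pow_pentagonal (hx : ‖x‖ < 1) :
    Summable fun k : ℤ => ‖x‖ ^ pentagonal k :=
  (summable_geometric_of_lt_one (norm_nonneg x) hx).comp_injective pentagonal_injective

theorem summable_negOnePow_mul_pow_pentagonal (hx : ‖x‖ < 1) :
    Summable fun k : ℤ => (-1 : ℂ) ^ k * x ^ pentagonal k :=
  .of_norm <| by simpa using summable_pow_pentagonal hx

/-- **Euler's pentagonal number theorem** in the unit disc. -/
theorem hasSum_pow_pentagonal (hx : ‖x‖ < 1) :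
    HasSum (fun k : ℤ => (-1 : ℂ) ^ k * x ^ pentagonal k) (∏' n : ℕ, (1 - x ^ (n + 1))) := by
  have hgeom := summable_geometric_of_lt_one (norm_nonneg x) hx
  set C := Real.exp (∑' i : ℕ, ‖x‖ ^ i)
  have hbound (k n : ℕ) :
      ‖x ^ ((k + 1) * n) * ∏ i ∈ Finset.range (n + 1), (1 - x ^ (k + i + 1))‖ ≤
        ‖x‖ ^ n * C := by
    rw [norm_mul, norm_pow]
    refine mul_le_mul ?_ (norm_prod_one_sub_pow_le hx k _) (norm_nonneg _) (by positivity)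
    exact pow_le_pow_of_le_one (norm_nonneg x) hx.le (by nlinarith)
  have hZ : HasSum (fun k : ℕ =>
      (-1 : ℂ) ^ k * (x ^ pentagonal (-k) - x ^ pentagonal (k + 1)))
      (∑' k : ℤ, (-1 : ℂ) ^ k * x ^ pentagonal k) := by
    have h := (summable_negOnePow_mul_pow_pentagonal hx).hasSum
    -- After reflection, the pairing of `k` with `-(k + 1)` becomes that of `-k` with `k + 1`.
    rw [← (Equiv.neg ℤ).hasSum_iff] at h
    convert h.nat_add_neg_add_one using 2 with k
    simp only [Function.comp_apply, Equiv.neg_apply, neg_neg, zpow_neg,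
      zpow_add_one₀ (neg_ne_zero.mpr (one_ne_zero' ℂ)), zpow_natCast, ← inv_pow, inv_neg_one]
    ring
  have hP := Pentagonal.tprod_one_sub_pow (x := x)
    (tendsto_pow_atTop_nhds_zero_of_norm_lt_one hx)
    (fun k => .of_norm_bounded (hgeom.mul_right C) (hbound k))
    (fun k => by
      convert multipliable_one_sub_mul_pow hx (x ^ (k + 1)) using 3
      ring)
    hZ.summable
    (by
      -- The remainder vanishes: its power of `x` has exponent at least `k`, and its series is
      -- bounded uniformly in `k`.
      refine squeeze_zero_norm (a := fun k : ℕ => ‖x‖ ^ k * ∑' n : ℕ, ‖x‖ ^ n * C)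
        (fun k => ?_) ?_
      · rw [norm_mul, norm_mul, norm_pow, norm_neg, norm_one, one_pow, one_mul, norm_pow]
        refine mul_le_mul ?_ (tsum_of_norm_bounded (hgeom.mul_right C).hasSum (hbound k))
          (norm_nonneg _) (by positivity)
        refine pow_le_pow_of_le_one (norm_nonneg x) hx.le ?_
        rw [Nat.le_div_iff_mul_le two_pos]
        nlinarith
      · simpa using (tendsto_pow_atTop_nhds_zero_of_lt_one (norm_nonneg x) hx).mul_const
          (∑' n : ℕ, ‖x‖ ^ n * C))
  rw [hP, hZ.tsum_eq]
  exact (summable_negOnePow_mul_pow_pentagonal hx).hasSum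

/-- The parity of a pentagonal number depends on its index mod 4: residues 1 and 2 are the odd ones.
Residue 2 is expressed in `j + 1` to match the second exponent of the theorem, whence the later
shifts by one. -/
theorem pentagonal_four_mul (j : ℤ) : (pentagonal (4 * j) : ℤ) = 2 * (12 * j ^ 2 - j) := by
  linarith [two_mul_natCast_pentagonal (4 * j)]

theorem pentagonal_four_mul_add_one (j : ℤ) :
    (pentagonal (4 * j + 1) : ℤ) = 2 * (12 * j ^ 2 + 5 * j) + 1 := by
  linarith [two_mul_natCast_pentagonal (4 * j + 1)]

theorem pentagonal_four_mul_add_two (j : ℤ) : (pentagonal (4 * j + 2) : ℤ) =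
    2 * (12 * (j + 1) ^ 2 - 13 * (j + 1) + 3) + 1 := by
  linarith [two_mul_natCast_pentagonal (4 * j + 2)]

theorem pentagonal_four_mul_add_three (j : ℤ) :
    (pentagonal (4 * j + 3) : ℤ) = 2 * (12 * j ^ 2 + 17 * j + 6) := by
  linarith [two_mul_natCast_pentagonal (4 * j + 3)]

theorem summable_zpow_pentagonal_four_mul_add_one {t : ℂ} (ht0 : t ≠ 0) (ht : ‖t‖ < 1) :
    Summable fun k : ℤ => (t ^ 2) ^ (12 * k ^ 2 + 5 * k) := by
  have hinj : Function.Injective fun k : ℤ => 4 * k + 1 := fun a b h => by simpa using h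
  have h : Summable fun k : ℤ => t ^ pentagonal (4 * k + 1) :=
    .of_norm <| by simpa using! (summable_pow_pentagonal ht).comp_injective hinj
  refine (h.mul_left t⁻¹).congr fun k => ?_
  rw [← zpow_natCast t (pentagonal _), pentagonal_four_mul_add_one, zpow_add_one₀ ht0,
    mul_comm, mul_assoc, mul_inv_cancel₀ ht0, mul_one, zpow_mul]
  norm_cast

theorem summable_zpow_pentagonal_four_mul_add_two {t : ℂ} (ht0 : t ≠ 0) (ht : ‖t‖ < 1) :
    Summable fun k : ℤ => (t ^ 2) ^ (12 * k ^ 2 - 13 * k + 3) := by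
  have hinj : Function.Injective fun k : ℤ => 4 * k + 2 := fun a b h => by simpa using h
  have h : Summable fun k : ℤ => t ^ pentagonal (4 * k + 2) :=
    .of_norm <| by simpa using! (summable_pow_pentagonal ht).comp_injective hinj
  rw [← (Equiv.addRight (1 : ℤ)).summable_iff]
  refine (h.mul_left t⁻¹).congr fun k => ?_
  rw [← zpow_natCast t (pentagonal _), pentagonal_four_mul_add_two, zpow_add_one₀ ht0,
    mul_comm, mul_assoc, mul_inv_cancel₀ ht0, mul_one, zpow_mul]
  norm_cast

/-- The odd part of the pentagonal number theorem. -/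
theorem two_mul_mul_tsum_zpow {t : ℂ} (ht0 : t ≠ 0) (ht : ‖t‖ < 1) :
    2 * t * ∑' k : ℤ, ((t ^ 2) ^ (12 * k ^ 2 + 5 * k) - (t ^ 2) ^ (12 * k ^ 2 - 13 * k + 3)) =
      ∏' n : ℕ, (1 - (-t) ^ (n + 1)) - ∏' n : ℕ, (1 - t ^ (n + 1)) := by
  have hA := summable_zpow_pentagonal_four_mul_add_one ht0 ht
  have hB := summable_zpow_pentagonal_four_mul_add_two ht0 ht
  have hB' := hB.hasSum
  rw [← (Equiv.addRight (1 : ℤ)).hasSum_iff] at hB'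
  have hodd {n : ℕ} {e : ℤ} (h : (n : ℤ) = 2 * e + 1) :
      (-t) ^ n = -t ^ n ∧ t ^ n = t * (t ^ 2) ^ e := by
    refine ⟨Odd.neg_pow (by grind) t, ?_⟩
    rw [← zpow_natCast t n, h, zpow_add_one₀ ht0, zpow_mul, mul_comm]
    norm_cast
  have heven {n : ℕ} {e : ℤ} (h : (n : ℤ) = 2 * e) : (-t) ^ n = t ^ n :=
    Even.neg_pow (by grind) t
  have hD := (hasSum_pow_pentagonal (x := -t) (by simpa using ht)).sub (hasSum_pow_pentagonal ht)
  rw [← (Int.divModEquiv 4).symm.hasSum_iff] at hD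
  have hF := hD.prod_fiberwise fun j => hasSum_fintype _
  rw [hA.tsum_sub hB]
  refine ((hA.hasSum.sub hB').mul_left (2 * t)).unique (hF.congr_fun ?_)
  intro j
  have hs1 : (-1 : ℂ) ^ (4 * j + 1) = -1 := Odd.neg_one_zpow (by grind)
  have hs2 : (-1 : ℂ) ^ (4 * j + 2) = 1 := Even.neg_one_zpow (by grind)
  have hr (r : Fin 4) : (Int.divModEquiv 4).symm (j, r) = 4 * j + (r : ℕ) := by
    simp [Int.divModEquiv, mul_comm]
  obtain ⟨h1, h1'⟩ := hodd (pentagonal_four_mul_add_one j)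
  obtain ⟨h2, h2'⟩ := hodd (pentagonal_four_mul_add_two j)
  simp only [Fin.sum_univ_four, Function.comp_apply, hr, Fin.isValue, Fin.val_zero, Fin.val_one,
    Fin.val_two, show ((3 : Fin 4) : ℕ) = 3 from rfl, Nat.cast_zero, Nat.cast_one, Nat.cast_ofNat,
    add_zero, Equiv.coe_addRight]
  rw [heven (pentagonal_four_mul j), heven (pentagonal_four_mul_add_three j), h1, h2, h1', h2',
    hs1, hs2]
  ring

end Pentagonal

theorem corollary5p8 (q : ℂ) (hq : ‖q‖ < 1) :
    Multipliable (fun i : ℕ => 1 - q * q ^ i) ∧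
    qPochInf q q ≠ 0 ∧
    Summable (fun n : ℕ => q ^ (2 * n ^ 2 + 2 * n) / qPoch q q (2 * n + 1)) ∧
    Summable (fun k : ℤ => q ^ (12 * k ^ 2 + 5 * k) - q ^ (12 * k ^ 2 - 13 * k + 3)) ∧
    ∑' n : ℕ, q ^ (2 * n ^ 2 + 2 * n) / qPoch q q (2 * n + 1) =
      1 / qPochInf q q *
        ∑' k : ℤ, (q ^ (12 * k ^ 2 + 5 * k) - q ^ (12 * k ^ 2 - 13 * k + 3)) := by
  have hne := qPochInf_self_ne_zero hq
  refine ⟨multipliable_one_sub_mul_pow hq q, hne, ?_⟩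
  -- The main argument divides by `t`, so `q = 0` is separate; there only the index-zero terms
  -- survive.
  rcases eq_or_ne q 0 with rfl | hq0
  · have hL (n : ℕ) (hn : n ≠ 0) :
        (0 : ℂ) ^ (2 * n ^ 2 + 2 * n) / qPoch 0 0 (2 * n + 1) = 0 := by
      rw [zero_pow (by positivity), zero_div]
    have hR (k : ℤ) (hk : k ≠ 0) :
        (0 : ℂ) ^ (12 * k ^ 2 + 5 * k) - 0 ^ (12 * k ^ 2 - 13 * k + 3) = 0 := by
      have h1 : 12 * k ^ 2 + 5 * k ≠ 0 := by
        rw [show 12 * k ^ 2 + 5 * k = k * (12 * k + 5) by ring]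
        exact mul_ne_zero hk (by omega)
      have h2 : 12 * k ^ 2 - 13 * k + 3 ≠ 0 := by
        rw [show 12 * k ^ 2 - 13 * k + 3 = (3 * k - 1) * (4 * k - 3) by ring]
        exact mul_ne_zero (by omega) (by omega)
      rw [zero_zpow _ h1, zero_zpow _ h2, sub_zero]
    refine ⟨(hasSum_single 0 hL).summable, (hasSum_single 0 hR).summable, ?_⟩
    rw [tsum_eq_single 0 hL, tsum_eq_single 0 hR]
    simp [qPoch, qPochInf]
  obtain ⟨t, rfl⟩ : ∃ t : ℂ, q = t ^ 2 := ⟨_, (Complex.cpow_nat_inv_pow q two_ne_zero).symm⟩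
  have ht0 : t ≠ 0 := fun h => hq0 (by simp [h])
  have ht : ‖t‖ < 1 := by
    rw [norm_pow] at hq
    exact (pow_lt_one_iff_of_nonneg (norm_nonneg t) two_ne_zero).mp hq
  refine ⟨?_, (summable_zpow_pentagonal_four_mul_add_one ht0 ht).sub
    (summable_zpow_pentagonal_four_mul_add_two ht0 ht), ?_⟩
  · have ho : Function.Injective fun n : ℕ => 2 * n + 1 := fun a b h => by simpa using h
    have h := (summable_eulerTerm hq t).comp_injective ho
    simp_rw [Function.comp_def, eulerTerm_sq_odd] at h
    exact (summable_mul_left_iff ht0).mp h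
  · rw [one_div, eq_inv_mul_iff_mul_eq₀ hne]
    refine mul_left_cancel₀ (mul_ne_zero two_ne_zero ht0) ?_
    have hneg := qPochInf_mul_qPochInf_sq (t := -t) (by simpa using ht)
    rw [neg_sq] at hneg
    rw [two_mul_mul_tsum_zpow ht0 ht, ← hneg, ← qPochInf_mul_qPochInf_sq ht]
    linear_combination qPochInf (t ^ 2) (t ^ 2) * two_mul_mul_tsum_odd hq
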